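/- **Setting.** Let $G$ be a causal diagram, i.e. a finite directed acyclic graph, with nodes $\mathcal V\cup\{Z\}$, $Z\notin\mathcal V$, and let $X\ne Y$ be two nodes in $\mathcal V$. Every node has finitely many states; $Z$ has $pq$ states $z_1,\dots,z_{pq}$. Let $O$ be observational data compatible with $G$, i.e. a joint probability distribution $P$ of all nodes that factorizes as the product, over the nodes, of conditional probability tables (CPTs) of each node given its parents in $G$. Let $G'$ be the directed graph with nodes $\mathcal V\cup\{W,U\}$ in which $\mathrm{Pa}_{G'}(U)=\mathrm{Pa}_G(Z)$, $\mathrm{Pa}_{G'}(W)=\mathrm{Pa}_G(Z)\cup\{U\}$, and, for $H\in\mathcal V$, $\mathrm{Pa}_{G'}(H)=\mathrm{Pa}_G(H)$ if $Z\notin \mathrm{Pa}_G(H)$ and $\mathrm{Pa}_{G'}(H)=(\mathrm{Pa}_G(H)\setminus\{Z\})\cup\{W,U\}$ if $Z\in\mathrm{Pa}_G(H)$. Let $W$ have $p$ states and $U$ have $q$ states, let all other nodes keep their states, and let $O'$ be the joint distribution $P'$ obtained from $P$ by identifying the pair of states $(w_j,u_k)$ with $z_{(j-1)q+k}$. For a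 set $Q$ of nodes of $G$ let $Q'=Q$ if $Z\notin Q$ and $Q'=(Q\setminus\{Z\})\cup\{W,U\}$ if $Z\in Q$. **Conventions.** Paths have distinct nodes and may run along or against arrows; blocking is the one of $d$-separation; a back-door path from $A$ is a path with an arrow into $A$; a node counts among its descendants. $Q$ satisfies the *back-door criterion* relative to $(X,Y)$ if no node of $Q$ is a descendant of $X$ and $Q$ blocks every back-door path from $X$ to $Y$. $Q$ satisfies the *front-door criterion* relative to $(X,Y)$ if (i) every directed path from $X$ to $Y$ meets $Q$, (ii) every back-door path from $X$ to a node of $Q$ is blocked by the empty set, and (iii) every back-door path from $Q$ to $Y$ (it starts at a node of $Q$ and has no other node in $Q$) is blocked by $\{X\}$. In a causal model with given CPTs, $P(y\mid do(x))$ is obtained by deleting the factor of $X$ from the product of the CPTs, setting $X=x$, and summing over all states with $Y=y$. The *causal effects of $X$ on $Y$ with $(G,O)$* are the functions $(x,y)\mapsto P(y\mid do(x))$ of all causal models on $G$ whose observational distribution is $O$ (a single function when the effect is determined by $G$ and $O$). **Theorem.** 1. $G'$ is acyclic, $O'$ is compatible with $G'$, and $P'(w_j,u_k,t)=P(z_{(j-1)q+k},t)$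 for all $j,k$ and every joint state $t$ of any set of nodes in $\mathcal V$. 2. If $Q$ satisfies the back-door criterion relative to $(X,Y)$ in $G$, then $Q'$ satisfies it in $G'$, and the adjustment formula $\sum_a P(y\mid x,a)P(a)$ (over the joint states $a$ of the set) has the same value for $(O,Q)$ and $(O',Q')$. 3. If $Q$ satisfies the front-door criterion relative to $(X,Y)$ in $G$, then $Q'$ satisfies it in $G'$, and the adjustment formula $\sum_a P(a\mid x)\sum_{x'}P(y\mid x',a)P(x')$ has the same value for $(O,Q)$ and $(O',Q')$. 4. $(G,O)$ and $(G',O')$ are equivalent: the causal effects of $X$ on $Y$ with $(G,O)$ and with $(G',O')$ are the same. In particular, if $P(y\mid do(x))$ is determined by $(G,O)$, then it is determined by $(G',O')$ and has the same value. (In the adjustment formulas, a quotient with denominator $0$ is read as $0$.) -/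

import Mathlib

open scoped BigOperators

/-! ### Paths, d-separation, back-door and front-door criteria in a directed graph -/

section Graphs

variable {N : Type*}

/-- The directed graph has no directed cycle (in particular no loop). -/
def Digraph.Acyclic (G : Digraph N) : Prop :=
  ∀ n, ¬ Relation.TransGen G.Adj n n

/-- `d` is a descendant of `n`; as usual, a node counts among its own descendants. -/
def Digraph.Descendant (G : Digraph N) (n d : N) : Prop :=
  Relation.ReflTransGen G.Adj n d

/-- `p` is the list of nodes of a path between `a` and `b`: the nodes are distinct and
consecutive nodes are joined by an arrow, whatever its direction. -/
def Digraph.IsPath (G : Digraph N) (a b : N) (p : List N) : Prop :=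
  p.Nodup ∧ p.IsChain (fun m n => G.Adj m n ∨ G.Adj n m) ∧
    p.head? = some a ∧ p.getLast? = some b

/-- `p` is a directed path from `a` to `b`: all arrows point towards `b`. -/
def Digraph.IsDirectedPath (G : Digraph N) (a b : N) (p : List N) : Prop :=
  p.Nodup ∧ p.IsChain G.Adj ∧ p.head? = some a ∧ p.getLast? = some b

/-- A back-door path from `a` to `b`: a path between `a` and `b` with an arrow into `a`
(as `a` is an end of the path, this arrow is the first one on it). -/
def Digraph.IsBackDoorPath (G : Digraph N) (a b : N) (p : List N) : Prop :=
  G.IsPath a b p ∧ ∃ m, [a, m] <+: p ∧ G.Adj m a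

/-- The path `p` is blocked by `S`: it contains a chain or a fork whose middle node is in `S`,
or a collider such that neither the collision node nor any descendant of it is in `S`. -/
def Digraph.Blocked (G : Digraph N) (S : Set N) (p : List N) : Prop :=
  ∃ a b c, [a, b, c] <:+: p ∧
    ((((G.Adj a b ∧ G.Adj b c) ∨ (G.Adj c b ∧ G.Adj b a) ∨ (G.Adj b a ∧ G.Adj b c)) ∧ b ∈ S) ∨
      ((G.Adj a b ∧ G.Adj c b) ∧ ∀ d, G.Descendant b d → d ∉ S))

/-- The back-door criterion for `Q` relative to the ordered pair `(X, Y)`. -/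
def Digraph.BackDoor (G : Digraph N) (X Y : N) (Q : Finset N) : Prop :=
  (∀ n ∈ Q, ¬ G.Descendant X n) ∧
    ∀ p, G.IsBackDoorPath X Y p → G.Blocked (Q : Set N) p

/-- The front-door criterion for `Q` relative to the ordered pair `(X, Y)`.
"No back-door path from `X` to `Q`" means, as always in this criterion, no unblocked one
(nothing is conditioned on). A path from the set `Q` to `Y` is a path that starts at a node of
`Q` and has no other node in `Q`. -/
def Digraph.FrontDoor (G : Digraph N) (X Y : N) (Q : Finset N) : Prop :=
  (∀ p, G.IsDirectedPath X Y p → ∃ n ∈ p, n ∈ Q) ∧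
    (∀ n ∈ Q, ∀ p, G.IsBackDoorPath X n p → G.Blocked ∅ p) ∧
    ∀ n ∈ Q, ∀ p, G.IsBackDoorPath n Y p → (∀ m ∈ p, m ∈ Q → m = n) → G.Blocked {X} p

end Graphs

/-! ### Observational data, causal models and causal effects -/

section Models

variable {N : Type*}

/-- A joint state of all nodes, where node `n` has the `r n` states `0, …, r n - 1`. -/
abbrev JointState (r : N → ℕ) : Type _ := ∀ n, Fin (r n)

variable [Fintype N] [DecidableEq N]

/-- `P` is a probability distribution on the joint states. -/
def IsDistribution {r : N → ℕ} (P : JointState r → ℝ) : Prop :=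
  (∀ s, 0 ≤ P s) ∧ ∑ s, P s = 1

open Classical in
/-- The probability of an event. -/
noncomputable def prob {r : N → ℕ} (P : JointState r → ℝ) (E : JointState r → Prop) : ℝ :=
  ∑ s, if E s then P s else 0

/-- A causal (Bayesian network) model on `G`: for every node and every joint state of its
parents, a probability distribution on the states of the node. -/
structure CausalModel (G : Digraph N) (r : N → ℕ) where
  /-- `cpt n a i` is the conditional probability of state `i` of `n` when the parents of `n`
  are in the joint state `a`. -/
  cpt : ∀ n, (∀ m : {m // G.Adj m n}, Fin (r m)) → Fin (r n) → ℝ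
  cpt_nonneg : ∀ n a i, 0 ≤ cpt n a i
  cpt_sum : ∀ n a, ∑ i, cpt n a i = 1

/-- The observational distribution of a causal model: the product of all conditional
probabilities. -/
noncomputable def CausalModel.observational {G : Digraph N} {r : N → ℕ} (M : CausalModel G r)
    (s : JointState r) : ℝ :=
  ∏ n, M.cpt n (fun m => s m) (s n)

/-- The joint distribution under the intervention `do(X = x)`: the factor of `X` is removed and
`X` is held at `x` (truncated factorization). -/
noncomputable def CausalModel.interventional {G : Digraph N} {r : N → ℕ} (M : CausalModel G r)
    (X : N) (x : Fin (r X)) (s : JointState r) : ℝ :=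
  if s X = x then ∏ n ∈ Finset.univ.erase X, M.cpt n (fun m => s m) (s n) else 0

/-- The causal effect `P(y | do(x))` in a causal model. -/
noncomputable def CausalModel.effect {G : Digraph N} {r : N → ℕ} (M : CausalModel G r)
    (X Y : N) (x : Fin (r X)) (y : Fin (r Y)) : ℝ :=
  prob (M.interventional X x) (fun s => s Y = y)

/-- The distribution `P` is compatible with `G`: it factorizes into conditional probabilities of
the nodes given their parents. -/
def Compatible (G : Digraph N) {r : N → ℕ} (P : JointState r → ℝ) : Prop :=
  IsDistribution P ∧ ∃ M : CausalModel G r, M.observational = P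

/-- The causal effects of `X` on `Y` with the graph `G` and the data `P`, that is, the functions
`(x, y) ↦ P(y | do(x))` of all causal models on `G` with observational distribution `P`. If the
causal effect is determined by `G` and `P`, this set has exactly one element; else (which needs
conditioning events of probability zero) it has all the admissible ones. -/
def causalEffects (G : Digraph N) {r : N → ℕ} (P : JointState r → ℝ) (X Y : N) :
    Set (Fin (r X) → Fin (r Y) → ℝ) :=
  {e | ∃ M : CausalModel G r, M.observational = P ∧ e = M.effect X Y}

/-- The back-door adjustment formula `∑_a P(y | x, a) P(a)`, over the joint states `a` of `Q`. -/
noncomputable def backDoorFormula {r : N → ℕ} (P : JointState r → ℝ) (X Y : N) (Q : Finset N)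
    (x : Fin (r X)) (y : Fin (r Y)) : ℝ :=
  ∑ a : (∀ n : Q, Fin (r n)),
    prob P (fun s => s X = x ∧ s Y = y ∧ ∀ n : Q, s n = a n) /
      prob P (fun s => s X = x ∧ ∀ n : Q, s n = a n) *
        prob P (fun s => ∀ n : Q, s n = a n)

/-- The front-door adjustment formula `∑_a P(a | x) ∑_{x'} P(y | x', a) P(x')`, over the joint
states `a` of `Q` and the states `x'` of `X`. -/
noncomputable def frontDoorFormula {r : N → ℕ} (P : JointState r → ℝ) (X Y : N) (Q : Finset N)
    (x : Fin (r X)) (y : Fin (r Y)) : ℝ :=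
  ∑ a : (∀ n : Q, Fin (r n)),
    prob P (fun s => s X = x ∧ ∀ n : Q, s n = a n) / prob P (fun s => s X = x) *
      ∑ x' : Fin (r X),
        prob P (fun s => s X = x' ∧ s Y = y ∧ ∀ n : Q, s n = a n) /
          prob P (fun s => s X = x' ∧ ∀ n : Q, s n = a n) *
            prob P (fun s => s X = x')

end Models

/-! ### Replacing the node `Z` by two nodes `W` and `U` -/

section Split

/-- The nodes of the original graph: `Z` and the other ones. -/
inductive NodeZ (V : Type*) where
  | old (v : V)
  | z
  deriving DecidableEq, Fintype

/-- The nodes of the new graph: `W`, `U`, and the nodes other than `Z` of the original graph. -/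
inductive NodeWU (V : Type*) where
  | old (v : V)
  | w
  | u
  deriving DecidableEq, Fintype

variable {V : Type*}

/-- Numbers of states in the original graph: `r v` for `v ≠ Z`, and `p * q` for `Z`. -/
def statesZ (r : V → ℕ) (p q : ℕ) : NodeZ V → ℕ
  | .old v => r v
  | .z => p * q

/-- Numbers of states in the new graph: `r v` for an old node `v`, `p` for `W`, `q` for `U`. -/
def statesWU (r : V → ℕ) (p q : ℕ) : NodeWU V → ℕ
  | .old v => r v
  | .w => p
  | .u => q

/-- The new graph: `U` has the parents of `Z`; `W` has the parents of `Z` and `U`; every other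
node keeps its parents, except that `Z` is replaced by `W` and `U`. -/
def splitGraph (G : Digraph (NodeZ V)) : Digraph (NodeWU V) where
  Adj
    | .old a, .old b => G.Adj (.old a) (.old b)
    | .old a, .w => G.Adj (.old a) .z
    | .old a, .u => G.Adj (.old a) .z
    | .w, .old b => G.Adj .z (.old b)
    | .u, .old b => G.Adj .z (.old b)
    | .u, .w => True
    | .w, .w => False
    | .w, .u => False
    | .u, .u => False

/-- The state of the original nodes that a state of the new nodes stands for. With states counted
from `0`, `finProdFinEquiv (j, k) = j * q + k`. -/
def mergeState {r : V → ℕ} {p q : ℕ} (s : JointState (statesWU r p q)) :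
    JointState (statesZ r p q)
  | .old v => s (.old v)
  | .z => finProdFinEquiv ((s .w : Fin p), (s .u : Fin q))

/-- The new observational data: the pair of states of `W` and `U` is the state of `Z`. -/
def splitData {r : V → ℕ} {p q : ℕ} (P : JointState (statesZ r p q) → ℝ) :
    JointState (statesWU r p q) → ℝ :=
  fun s => P (mergeState s)

variable [DecidableEq V]

/-- `Q' = Q` if `Z ∉ Q`, and `Q' = (Q \ {Z}) ∪ {W, U}` if `Z ∈ Q`. -/
def splitSet [Fintype V] (Q : Finset (NodeZ V)) : Finset (NodeWU V) :=
  (Finset.univ.filter fun v : V => NodeZ.old v ∈ Q).image NodeWU.old ∪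
    if NodeZ.z ∈ Q then {NodeWU.w, NodeWU.u} else ∅

end Split

/-!
Let `W` and `U` go to `Z`, and every other node to itself. The fibres of this map are modules of the
new graph: nodes in the same fibre have the same arrows to and from the nodes outside it. So a path
of the new graph can be cut short between its first and its last node in a fibre, and maps to a path
of the original graph once it has at most one node in each fibre. Cutting can turn a node into a
collider only if the longer path leaves it along an arrow towards a collider; as that one is
unblocked, it has a descendant in the conditioning set, and the new collider is unblocked too. Hence
every unblocked path of the new graph comes down to an unblocked path of the original graph.

On the side of the data, the chain rule writes the conditional distribution of `Z` as the one of `U`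
times the one of `W` given `U`, and conversely such a product is a conditional distribution of `Z`.
Hence the causal models on both graphs correspond to each other with the same product of factors,
also after the factor of `X` has been removed, and all sums over joint states are merely re-indexed.
-/

section Lists

variable {α β : Type*} {f : α → β}

theorem triple_infix_append_cons {a b c z : α} {l₁ l₂ : List α}
    (h : [a, b, c] <:+: l₁ ++ z :: l₂) :
    [a, b, c] <:+: l₁ ++ [z] ∨ [a, b, c] <:+: z :: l₂ ∨
      (b = z ∧ [a] <:+ l₁ ∧ [c] <+: l₂) := by
  induction l₁ with
  | nil => exact .inr (.inl h)
  | cons x l₁ ih =>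
    rw [List.cons_append, List.infix_cons_iff] at h
    obtain h | h := h
    · match l₁ with
      | [] => grind
      | [y] => grind
      | y :: y' :: l =>
        refine .inl (List.IsPrefix.isInfix ?_)
        simpa [List.cons_prefix_cons] using h
    · obtain h | h | ⟨rfl, ha, hc⟩ := ih h
      · exact .inl (h.trans (List.suffix_cons _ _).isInfix)
      · exact .inr (.inl h)
      · exact .inr (.inr ⟨rfl, ha.trans (List.suffix_cons _ _), hc⟩)

theorem isChain_map_of_nodup_map {R : α → α → Prop} {R' : β → β → Prop}
    (hR : ∀ a b, f a ≠ f b → R a b → R' (f a) (f b)) {l : List α} (hl : l.IsChain R)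
    (hnd : (l.map f).Nodup) : (l.map f).IsChain R' := by
  induction hl with
  | nil => exact .nil
  | singleton => exact .singleton _
  | cons_cons hab _ ih =>
    obtain ⟨hne, hnd⟩ := List.nodup_cons.1 hnd
    exact .cons_cons (hR _ _ (fun h => hne (h ▸ List.mem_cons_self)) hab) (ih hnd)

/-- `Shortcut f p q` says that `q` arises from `p` by cutting out what follows some node, up to
and including the last node with the same value of `f`. -/
inductive Shortcut (f : α → β) : List α → List α → Prop
  | mk {l₁ m l₂ : List α} {c₁ c₂ : α} (hc : f c₁ = f c₂) (hne : f c₁ ∉ l₂.map f) :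
      Shortcut f (l₁ ++ c₁ :: (m ++ c₂ :: l₂)) (l₁ ++ c₁ :: l₂)

namespace Shortcut

variable {p q : List α}

theorem sublist (h : Shortcut f p q) : q.Sublist p := by
  obtain ⟨-, -⟩ := h
  exact .append_left (.cons_cons _ ((List.sublist_cons_self _ _).trans
    (List.sublist_append_right _ _))) _

theorem length_lt (h : Shortcut f p q) : q.length < p.length := by
  obtain ⟨-, -⟩ := h
  simp only [List.length_append, List.length_cons]
  lia

theorem head?_eq (h : Shortcut f p q) : q.head? = p.head? := by
  obtain ⟨-, -⟩ := h
  simp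

theorem getLast?_map_eq (h : Shortcut f p q) : (q.map f).getLast? = (p.map f).getLast? := by
  obtain ⟨hc, -⟩ := h
  simp only [List.map_append, List.map_cons, ← hc, List.getLast?_append_cons]
  rw [← List.cons_append, List.getLast?_append_cons]

theorem isChain {R : α → α → Prop} (hR : ∀ a b c, f a = f b → f a ≠ f c → R b c → R a c)
    (h : Shortcut f p q) (hp : p.IsChain R) : q.IsChain R := by
  obtain @⟨l₁, m, l₂, c₁, c₂, hc, hne⟩ := h
  obtain ⟨hp₁, hp⟩ := List.isChain_split.1 hp
  rw [← List.cons_append, List.isChain_split, List.isChain_cons (l := l₂)] at hp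
  obtain ⟨-, hhead, htail⟩ := hp
  refine List.isChain_split.2 ⟨hp₁, List.isChain_cons.2 ⟨fun t ht => ?_, htail⟩⟩
  refine hR _ _ _ hc (fun h => hne ?_) (hhead t ht)
  exact List.mem_map.2 ⟨t, List.mem_of_mem_head? ht, h.symm⟩

theorem exists_of_not_nodup_map {l : List α} (h : ¬ (l.map f).Nodup) : ∃ q, Shortcut f l q := by
  have last_occurrence : ∀ {b : β} {t : List α}, b ∈ t.map f →
      ∃ m c l₂, t = m ++ c :: l₂ ∧ f c = b ∧ b ∉ l₂.map f := by
    intro b t hb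
    induction t with
    | nil => simp at hb
    | cons a t ih =>
      by_cases hbt : b ∈ t.map f
      · obtain ⟨m, c, l₂, rfl, hc⟩ := ih hbt
        exact ⟨a :: m, c, l₂, rfl, hc⟩
      · exact ⟨[], a, t, rfl, by grind, hbt⟩
  induction l with
  | nil => simp at h
  | cons a t ih =>
    by_cases hat : f a ∈ t.map f
    · obtain ⟨m, c, l₂, rfl, hc, hne⟩ := last_occurrence hat
      exact ⟨_, .mk (l₁ := []) hc.symm hne⟩
    · obtain ⟨_, hc, hne⟩ := ih fun ht => h (List.nodup_cons.2 ⟨hat, ht⟩)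
      exact ⟨_, .mk (l₁ := a :: _) hc hne⟩

theorem exists_nodup_map {C : List α → Prop} (hC : ∀ p q, Shortcut f p q → C p → C q) (hp : C p) :
    ∃ q, q.Sublist p ∧ C q ∧ (q.map f).Nodup := by
  induction hn : p.length using Nat.strong_induction_on generalizing p with
  | _ n ih =>
    by_cases hnd : (p.map f).Nodup
    · exact ⟨p, .refl p, hp, hnd⟩
    · obtain ⟨p', hp'⟩ := exists_of_not_nodup_map hnd
      obtain ⟨q, hq, h⟩ := ih _ (hn ▸ hp'.length_lt) (hC _ _ hp' hp) rfl
      exact ⟨q, hq.trans hp'.sublist, h⟩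

end Shortcut

end Lists

section Blocking

variable {N : Type*} {G : Digraph N} {S : Set N}

/-- The consecutive nodes `a, b, c` of a path block it, given `S`; thus `G.Blocked S p` says that
some three consecutive nodes of `p` do so. -/
def BlocksAt (G : Digraph N) (S : Set N) (a b c : N) : Prop :=
  (((G.Adj a b ∧ G.Adj b c) ∨ (G.Adj c b ∧ G.Adj b a) ∨ (G.Adj b a ∧ G.Adj b c)) ∧ b ∈ S) ∨
    ((G.Adj a b ∧ G.Adj c b) ∧ ∀ d, G.Descendant b d → d ∉ S)

theorem blocksAt_of_mem {a b c : N} (hab : G.Adj a b ∨ G.Adj b a) (hbc : G.Adj b c ∨ G.Adj c b)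
    (h : G.Adj b a ∨ G.Adj b c) (hb : b ∈ S) : BlocksAt G S a b c :=
  .inl ⟨by tauto, hb⟩

theorem blocked_of_infix {p q : List N} (h : q <:+: p) : G.Blocked S q → G.Blocked S p :=
  fun ⟨a, b, c, habc, hb⟩ => ⟨a, b, c, habc.trans h, hb⟩

/-- Following the arrows from `b` one meets a collider, and an unblocked one has a descendant
in `S`. -/
theorem exists_descendant_mem_of_not_blocked {a b c d : N} {t : List N}
    (hp : ¬ G.Blocked S (a :: b :: t))
    (hch : (a :: b :: t).IsChain fun m n => G.Adj m n ∨ G.Adj n m)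
    (hab : G.Adj a b) (hs : [c, d] <:+ b :: t) (hdc : G.Adj d c) :
    ∃ s ∈ S, G.Descendant b s := by
  induction t generalizing a b with
  | nil => simpa using hs.length_le
  | cons e t ih =>
    have of_collider (heb : G.Adj e b) : ∃ s ∈ S, G.Descendant b s := by
      by_contra! h
      exact hp ⟨a, b, e, ⟨[], t, rfl⟩, .inr ⟨⟨hab, heb⟩, fun s hs hS => h s hS hs⟩⟩
    have hch' := (List.isChain_cons_cons.1 hch).2
    obtain hs | hs := List.suffix_cons_iff.1 hs
    · obtain ⟨rfl, rfl, -⟩ : c = b ∧ d = e ∧ [] = t := by simpa using hs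
      exact of_collider hdc
    · obtain hbe | heb := (List.isChain_cons_cons.1 hch').1
      · obtain ⟨s, hsS, hes⟩ :=
          ih (fun h => hp (blocked_of_infix (List.suffix_cons _ _).isInfix h)) hch' hbe hs
        exact ⟨s, hsS, .head hbe hes⟩
      · exact of_collider heb

end Blocking

section Contraction

variable {N' N : Type*} {H : Digraph N'} {G : Digraph N} {f : N' → N}

/-- `G` is the quotient of `H` by the fibres of `f`: two nodes in different fibres are joined in `H`
exactly as their images are in `G`, i.e. the fibres are modules of `H`. Arrows within a fibre and
loops of `G` are left free. -/
structure IsModularQuotient (H : Digraph N') (G : Digraph N) (f : N' → N) : Prop where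
  surjective : f.Surjective
  adj_iff {a b : N'} : f a ≠ f b → (H.Adj a b ↔ G.Adj (f a) (f b))

namespace IsModularQuotient

variable {S : Set N} {a b c d : N'} {m p q l : List N'}

theorem acyclic (h : IsModularQuotient H G f) (hG : G.Acyclic)
    (hf : ∀ a, ¬ Relation.TransGen (fun a b => H.Adj a b ∧ f a = f b) a a) : H.Acyclic := by
  have transGen_or {a b : N'} (hab : Relation.TransGen H.Adj a b) :
      Relation.TransGen G.Adj (f a) (f b) ∨
        f a = f b ∧ Relation.TransGen (fun a b => H.Adj a b ∧ f a = f b) a b := by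
    induction hab with
    | @single b hab =>
      by_cases hfab : f a = f b
      · exact .inr ⟨hfab, .single ⟨hab, hfab⟩⟩
      · exact .inl (.single ((h.adj_iff hfab).1 hab))
    | @tail b c _ hbc ih =>
      by_cases hfbc : f b = f c
      · exact ih.imp (hfbc ▸ ·) fun ⟨hfab, hab⟩ => ⟨hfab.trans hfbc, hab.tail ⟨hbc, hfbc⟩⟩
      · have hbc' := (h.adj_iff hfbc).1 hbc
        exact .inl (ih.elim (·.tail hbc') fun ⟨hfab, _⟩ => .single (hfab ▸ hbc'))
  exact fun a ha => (transGen_or ha).elim (hG _) fun ha => hf a ha.2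

theorem descendant_map (h : IsModularQuotient H G f) (hab : H.Descendant a b) :
    G.Descendant (f a) (f b) := by
  induction hab with
  | refl => exact .refl
  | @tail b c _ hbc ih =>
    by_cases hfbc : f b = f c
    · exact hfbc ▸ ih
    · exact .tail ih ((h.adj_iff hfbc).1 hbc)

theorem exists_descendant {d : N} (h : IsModularQuotient H G f) (had : G.Descendant (f a) d) :
    ∃ b, f b = d ∧ H.Descendant a b := by
  induction had with
  | refl => exact ⟨a, rfl, .refl⟩
  | @tail d e _ hde ih =>
    obtain ⟨b, rfl, hab⟩ := ih
    obtain ⟨c, rfl⟩ := h.surjective e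
    by_cases hfbc : f b = f c
    · exact ⟨b, hfbc, hab⟩
    · exact ⟨c, rfl, .tail hab ((h.adj_iff hfbc).2 hde)⟩

theorem forall_descendant_notMem_iff (h : IsModularQuotient H G f) :
    (∀ d, H.Descendant a d → d ∉ f ⁻¹' S) ↔ ∀ d, G.Descendant (f a) d → d ∉ S := by
  constructor
  · intro hS d had
    obtain ⟨b, rfl, hab⟩ := h.exists_descendant had
    exact hS b hab
  · exact fun hS d had => hS _ (h.descendant_map had)

theorem blocksAt_iff (h : IsModularQuotient H G f) (hab : f a ≠ f b) (hbc : f b ≠ f c) :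
    BlocksAt H (f ⁻¹' S) a b c ↔ BlocksAt G S (f a) (f b) (f c) := by
  unfold BlocksAt
  rw [h.forall_descendant_notMem_iff, h.adj_iff hab, h.adj_iff hab.symm, h.adj_iff hbc,
    h.adj_iff hbc.symm, Set.mem_preimage]

theorem isPath_map (h : IsModularQuotient H G f) (hp : H.IsPath a b p) (hnd : (p.map f).Nodup) :
    G.IsPath (f a) (f b) (p.map f) := by
  obtain ⟨-, hch, hhead, hlast⟩ := hp
  refine ⟨hnd, isChain_map_of_nodup_map (fun x y hxy => ?_) hch hnd, by simp [hhead],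
    by simp [hlast]⟩
  rw [h.adj_iff hxy, h.adj_iff hxy.symm]
  exact id

theorem isDirectedPath_map (h : IsModularQuotient H G f) (hp : H.IsDirectedPath a b p)
    (hnd : (p.map f).Nodup) : G.IsDirectedPath (f a) (f b) (p.map f) := by
  obtain ⟨-, hch, hhead, hlast⟩ := hp
  exact ⟨hnd, isChain_map_of_nodup_map (fun x y hxy => (h.adj_iff hxy).1) hch hnd, by simp [hhead],
    by simp [hlast]⟩

theorem isBackDoorPath_map (h : IsModularQuotient H G f) (hp : H.IsBackDoorPath a b p)
    (hnd : (p.map f).Nodup) : G.IsBackDoorPath (f a) (f b) (p.map f) := by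
  obtain ⟨hpath, m, hm, hma⟩ := hp
  have hm' : [f a, f m] <+: p.map f := hm.map f
  have hne : f m ≠ f a := by
    have := hnd.sublist hm'.sublist
    grind
  exact ⟨h.isPath_map hpath hnd, f m, hm', (h.adj_iff hne).1 hma⟩

theorem blocked_of_blocked_map (h : IsModularQuotient H G f) (hnd : (p.map f).Nodup)
    (hb : G.Blocked S (p.map f)) : H.Blocked (f ⁻¹' S) p := by
  obtain ⟨x, y, z, hxyz, hb⟩ := hb
  obtain ⟨t, ht, hxyz'⟩ := List.infix_map_iff.1 hxyz
  obtain ⟨a, b, c, rfl⟩ : ∃ a b c, t = [a, b, c] :=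
    List.length_eq_three.1 (by simpa using (congrArg List.length hxyz').symm)
  obtain ⟨rfl, rfl, rfl⟩ : x = f a ∧ y = f b ∧ z = f c := by simpa using hxyz'
  have hnd' := hnd.sublist hxyz.sublist
  exact ⟨a, b, c, ht, (h.blocksAt_iff (by grind) (by grind)).2 hb⟩

theorem adj_congr_left (h : IsModularQuotient H G f) (hab : f a = f b) (hac : f a ≠ f c) :
    H.Adj a c ↔ H.Adj b c := by
  rw [h.adj_iff hac, h.adj_iff (hab ▸ hac), hab]

theorem adj_congr_right (h : IsModularQuotient H G f) (hab : f a = f b) (hac : f a ≠ f c) :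
    H.Adj c a ↔ H.Adj c b := by
  rw [h.adj_iff hac.symm, h.adj_iff (hab ▸ hac.symm), hab]

theorem adj_or_adj_congr_left (h : IsModularQuotient H G f) (hab : f a = f b) (hac : f a ≠ f c) :
    H.Adj a c ∨ H.Adj c a ↔ H.Adj b c ∨ H.Adj c b := by
  rw [h.adj_congr_left hab hac, h.adj_congr_right hab hac]

theorem isPath_shortcut (h : IsModularQuotient H G f) (hs : Shortcut f p q)
    (hp : H.IsPath a b p) : ∃ b', f b' = f b ∧ H.IsPath a b' q := by
  obtain ⟨hnd, hch, hhead, hlast⟩ := hp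
  have hlast' : q.getLast?.map f = some (f b) := by
    rw [← List.getLast?_map, hs.getLast?_map_eq, List.getLast?_map, hlast, Option.map_some]
  obtain ⟨b', hb', hfb⟩ := Option.map_eq_some_iff.1 hlast'
  exact ⟨b', hfb, hnd.sublist hs.sublist,
    hs.isChain (fun _ _ _ hxy hxz => (h.adj_or_adj_congr_left hxy hxz).2) hch,
    hs.head?_eq.trans hhead, hb'⟩

theorem isDirectedPath_shortcut (h : IsModularQuotient H G f) (hs : Shortcut f p q)
    (hp : H.IsDirectedPath a b p) : ∃ b', f b' = f b ∧ H.IsDirectedPath a b' q := by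
  obtain ⟨hnd, hch, hends⟩ := hp
  obtain ⟨b', hfb, hnd', -, hends'⟩ := h.isPath_shortcut hs ⟨hnd, hch.imp fun _ _ => .inl, hends⟩
  exact ⟨b', hfb, hnd', hs.isChain (fun _ _ _ hxy hxz => (h.adj_congr_left hxy hxz).2) hch, hends'⟩

theorem isBackDoorPath_shortcut (h : IsModularQuotient H G f) (hs : Shortcut f p q)
    (hp : H.IsBackDoorPath a b p) (ha : ∀ n ∈ p, f n = f a → n = a) :
    ∃ b', f b' = f b ∧ H.IsBackDoorPath a b' q := by
  obtain ⟨hpath, x, hx, hxa⟩ := hp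
  obtain ⟨b', hfb, hpath'⟩ := h.isPath_shortcut hs hpath
  refine ⟨b', hfb, hpath', x, ?_, hxa⟩
  obtain @⟨l₁, m, l₂, c₁, c₂, hc, -⟩ := hs
  cases l₁ with
  | nil =>
    -- Cutting at `a` itself would require a second node in the fibre of `a`.
    have hac : a = c₁ := (List.cons_prefix_cons.1 hx).1
    have hca : c₂ = a := ha c₂ (by simp) (by rw [hac, hc])
    have := hpath.1
    simp [← hac, hca] at this
  | cons y l =>
    obtain ⟨rfl, hx⟩ := List.cons_prefix_cons.1 hx
    refine List.cons_prefix_cons.2 ⟨rfl, ?_⟩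
    cases l with
    | nil => simpa using hx
    | cons y' l => simpa using hx

/-- Cutting out `m` and `d` leaves `a, c, b`. A chain or fork there is one at `c` or at `d` in the
longer path, and a collider there leads along arrows from `c` to a collider of the longer path. -/
theorem blocked_of_blocksAt (h : IsModularQuotient H G f) (hc : f c = f d) (hb : f c ≠ f b)
    (hch : (a :: c :: (m ++ [d, b])).IsChain fun x y => H.Adj x y ∨ H.Adj y x)
    (hbl : BlocksAt H (f ⁻¹' S) a c b) : H.Blocked (f ⁻¹' S) (a :: c :: (m ++ [d, b])) := by
  obtain ⟨x, t, hx⟩ : ∃ x t, m ++ [d, b] = x :: t := List.exists_cons_of_ne_nil (by simp)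
  obtain ⟨s, y, hy⟩ : ∃ s y, c :: m = s ++ [y] :=
    ⟨_, _, (List.dropLast_append_getLast (List.cons_ne_nil c m)).symm⟩
  have hac := (List.isChain_cons_cons.1 hch).1
  have hcx : H.Adj c x ∨ H.Adj x c := by
    rw [hx] at hch
    exact (List.isChain_cons_cons.1 (List.isChain_cons_cons.1 hch).2).1
  have hyd_infix : [y, d, b] <:+: a :: c :: (m ++ [d, b]) :=
    ⟨a :: s, [], by simpa using congrArg (· ++ [d, b]) hy.symm⟩
  obtain ⟨hyd, hdb⟩ : (H.Adj y d ∨ H.Adj d y) ∧ (H.Adj d b ∨ H.Adj b d) := by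
    simpa using hch.infix hyd_infix
  obtain ⟨hfork, hcS⟩ | ⟨⟨hac', hbc⟩, hcS⟩ := hbl
  · have hout : H.Adj c a ∨ H.Adj c b := by tauto
    obtain hca | hcb := hout
    · exact ⟨a, c, x, ⟨[], t, by simp [hx]⟩, blocksAt_of_mem hac hcx (.inl hca) hcS⟩
    · have hdS : d ∈ f ⁻¹' S := by rwa [Set.mem_preimage, ← hc]
      exact ⟨y, d, b, hyd_infix,
        blocksAt_of_mem hyd hdb (.inr ((h.adj_congr_left hc hb).1 hcb)) hdS⟩
  · by_contra hopen
    obtain ⟨e, heS, hce⟩ := exists_descendant_mem_of_not_blocked hopen hch hac' ⟨c :: m, by simp⟩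
      ((h.adj_congr_right hc hb).1 hbc)
    exact hcS e hce heS

theorem blocked_of_blocked_shortcut (h : IsModularQuotient H G f) (hs : Shortcut f p q)
    (hp : p.IsChain fun x y => H.Adj x y ∨ H.Adj y x) (hq : H.Blocked (f ⁻¹' S) q) :
    H.Blocked (f ⁻¹' S) p := by
  obtain @⟨l₁, m, l₂, c₁, c₂, hc, hne⟩ := hs
  obtain ⟨a, b, c, habc, hb⟩ := hq
  obtain hl | hr | ⟨rfl, ha, hcl⟩ := triple_infix_append_cons habc
  · exact ⟨a, b, c, hl.trans ⟨[], m ++ c₂ :: l₂, by simp⟩, hb⟩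
  · obtain hr | hr := List.infix_cons_iff.1 hr
    · obtain ⟨rfl, t, rfl⟩ := List.cons_prefix_cons.1 hr
      have hab : f a ≠ f b := fun hab => hne (hab ▸ List.mem_map_of_mem List.mem_cons_self)
      refine ⟨c₂, b, c, ⟨l₁ ++ a :: m, t, by simp⟩, ?_⟩
      rwa [← h.adj_congr_left hc hab, ← h.adj_congr_right hc hab]
    · exact ⟨a, b, c, hr.trans ⟨l₁ ++ c₁ :: (m ++ [c₂]), [], by simp⟩, hb⟩
  · obtain ⟨s, rfl⟩ := ha
    obtain ⟨t, rfl⟩ := hcl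
    refine blocked_of_infix (q := a :: b :: (m ++ [c₂, c])) ⟨s, t, by simp⟩ ?_
    refine h.blocked_of_blocksAt hc ?_ (hp.infix ⟨s, t, by simp⟩) hb
    exact fun hbc => hne (hbc ▸ List.mem_map_of_mem List.mem_cons_self)

theorem exists_directedPath (h : IsModularQuotient H G f) (hp : H.IsDirectedPath a b p) :
    ∃ q, G.IsDirectedPath (f a) (f b) q ∧ q ⊆ p.map f := by
  obtain ⟨q, hqp, ⟨b', hfb, hq⟩, hnd⟩ := Shortcut.exists_nodup_map (f := f)
    (C := fun p => ∃ b', f b' = f b ∧ H.IsDirectedPath a b' p)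
    (fun _ _ hs ⟨_, hfb, hp⟩ => hfb ▸ h.isDirectedPath_shortcut hs hp) ⟨b, rfl, hp⟩
  exact ⟨q.map f, hfb ▸ h.isDirectedPath_map hq hnd, (hqp.map f).subset⟩

theorem exists_backDoorPath (h : IsModularQuotient H G f) (hp : H.IsBackDoorPath a b p)
    (ha : ∀ n ∈ p, f n = f a → n = a) (hopen : ¬ H.Blocked (f ⁻¹' S) p) :
    ∃ q, G.IsBackDoorPath (f a) (f b) q ∧ ¬ G.Blocked S q ∧ q ⊆ p.map f := by
  let C (p : List N') : Prop := (∃ b', f b' = f b ∧ H.IsBackDoorPath a b' p) ∧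
    (∀ n ∈ p, f n = f a → n = a) ∧ ¬ H.Blocked (f ⁻¹' S) p
  have hC : ∀ p q, Shortcut f p q → C p → C q := by
    rintro p q hs ⟨⟨b', hfb, hp⟩, ha, hopen⟩
    exact ⟨hfb ▸ h.isBackDoorPath_shortcut hs hp ha, fun n hn => ha n (hs.sublist.subset hn),
      fun hq => hopen (h.blocked_of_blocked_shortcut hs hp.1.2.1 hq)⟩
  obtain ⟨q, hqp, ⟨⟨b', hfb, hq⟩, -, hopen⟩, hnd⟩ :=
    Shortcut.exists_nodup_map hC ⟨⟨b, rfl, hp⟩, ha, hopen⟩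
  exact ⟨q.map f, hfb ▸ h.isBackDoorPath_map hq hnd,
    fun hb => hopen (h.blocked_of_blocked_map hnd hb), (hqp.map f).subset⟩

variable {X Y : N'} {Q' : Finset N'} {Q : Finset N}

theorem backDoor (h : IsModularQuotient H G f) (hQ : ∀ n, n ∈ Q' ↔ f n ∈ Q)
    (hX : ∀ n, f n = f X → n = X) (hG : G.BackDoor (f X) (f Y) Q) : H.BackDoor X Y Q' := by
  have hQ' : (Q' : Set N') = f ⁻¹' Q := Set.ext hQ
  refine ⟨fun n hn hXn => hG.1 _ ((hQ n).1 hn) (h.descendant_map hXn), fun p hp => ?_⟩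
  by_contra hopen
  obtain ⟨q, hq, hqopen, -⟩ := h.exists_backDoorPath hp (fun n _ => hX n) (hQ' ▸ hopen)
  exact hqopen (hG.2 q hq)

theorem frontDoor (h : IsModularQuotient H G f) (hQ : ∀ n, n ∈ Q' ↔ f n ∈ Q)
    (hX : ∀ n, f n = f X → n = X) (hG : G.FrontDoor (f X) (f Y) Q) : H.FrontDoor X Y Q' := by
  obtain ⟨hdir, hXQ, hQY⟩ := hG
  refine ⟨fun p hp => ?_, fun n hn p hp => ?_, fun n hn p hp hpn => ?_⟩
  · obtain ⟨q, hq, hqp⟩ := h.exists_directedPath hp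
    obtain ⟨m, hmq, hmQ⟩ := hdir q hq
    obtain ⟨n, hnp, rfl⟩ := List.mem_map.1 (hqp hmq)
    exact ⟨n, hnp, (hQ n).2 hmQ⟩
  · by_contra hopen
    obtain ⟨q, hq, hqopen, -⟩ := h.exists_backDoorPath (S := ∅) hp (fun n _ => hX n) hopen
    exact hqopen (hXQ _ ((hQ n).1 hn) q hq)
  · have hfX : f ⁻¹' {f X} = {X} := Set.ext fun n => ⟨hX n, fun hn => congrArg f hn⟩
    by_contra hopen
    obtain ⟨q, hq, hqopen, hqp⟩ := h.exists_backDoorPath (S := {f X}) hp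
      (fun m hm hmn => hpn m hm ((hQ m).2 (hmn ▸ (hQ n).1 hn))) (hfX ▸ hopen)
    refine hqopen (hQY _ ((hQ n).1 hn) q hq fun m hmq hmQ => ?_)
    obtain ⟨m, hmp, rfl⟩ := List.mem_map.1 (hqp hmq)
    exact congrArg f (hpn m hmp ((hQ m).2 hmQ))

end IsModularQuotient

end Contraction

section SplitGraph

variable {V : Type*} {G : Digraph (NodeZ V)}

/-- The node of the original graph that a node of the new graph comes from. -/
def NodeWU.merge : NodeWU V → NodeZ V
  | .old v => .old v
  | .w => .z
  | .u => .z

theorem isModularQuotient_splitGraph (G : Digraph (NodeZ V)) :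
    IsModularQuotient (splitGraph G) G NodeWU.merge where
  surjective
    | .old v => ⟨.old v, rfl⟩
    | .z => ⟨.w, rfl⟩
  adj_iff {a b} hab := by cases a <;> cases b <;> first | rfl | exact absurd rfl hab

theorem eq_u_and_eq_w_of_adj {a b : NodeWU V} (hG : ∀ v, ¬ G.Adj v v)
    (hab : (splitGraph G).Adj a b) (hmerge : a.merge = b.merge) : a = .u ∧ b = .w := by
  cases a <;> cases b <;> simp_all [splitGraph, NodeWU.merge]

theorem splitGraph_acyclic (hG : G.Acyclic) : (splitGraph G).Acyclic := by
  have hloop : ∀ v, ¬ G.Adj v v := fun v hv => hG v (.single hv)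
  refine (isModularQuotient_splitGraph G).acyclic hG fun a ha => ?_
  obtain ⟨b, ⟨hab, hmab⟩, -⟩ := Relation.TransGen.head'_iff.1 ha
  obtain ⟨c, -, hca, hmca⟩ := Relation.TransGen.tail'_iff.1 ha
  have hau := (eq_u_and_eq_w_of_adj hloop hab hmab).1
  have haw := (eq_u_and_eq_w_of_adj hloop hca hmca).2
  cases hau.symm.trans haw

theorem mem_splitSet [Fintype V] [DecidableEq V] {Q : Finset (NodeZ V)} {n : NodeWU V} :
    n ∈ splitSet Q ↔ n.merge ∈ Q := by
  unfold splitSet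
  split_ifs <;> cases n <;> simp_all [NodeWU.merge]

theorem NodeWU.eq_old_of_merge_eq {v : V} {n : NodeWU V} (h : n.merge = .old v) : n = .old v := by
  cases n <;> simp_all [NodeWU.merge]

end SplitGraph
section CausalModels

variable {N : Type*} {G : Digraph N} {r : N → ℕ}

namespace CausalModel

/-- The factor of the node `n` in the product of all conditional probabilities. -/
def factor (M : CausalModel G r) (n : N) (s : JointState r) : ℝ :=
  M.cpt n (fun m => s m) (s n)

variable {M : CausalModel G r} {n : N} {s t : JointState r}

theorem factor_nonneg : 0 ≤ M.factor n s :=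
  M.cpt_nonneg _ _ _

theorem factor_congr (hpa : ∀ m, G.Adj m n → s m = t m) (hn : s n = t n) :
    M.factor n s = M.factor n t := by
  have hpa' : (fun m : {m // G.Adj m n} => s m) = fun m : {m // G.Adj m n} => t m :=
    funext fun m => hpa m m.2
  unfold factor
  rw [hn, hpa']

theorem factor_update_of_not_adj [DecidableEq N] {m : N} (hmn : m ≠ n) (hm : ¬ G.Adj m n)
    (i : Fin (r m)) : M.factor n (Function.update s m i) = M.factor n s :=
  factor_congr (fun _ hadj => Function.update_of_ne (by rintro rfl; exact hm hadj) _ _)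
    (Function.update_of_ne hmn.symm _ _)

theorem sum_factor_update [DecidableEq N] (hn : ¬ G.Adj n n) :
    ∑ i, M.factor n (Function.update s n i) = 1 := by
  rw [← M.cpt_sum n fun m => s m]
  refine Finset.sum_congr rfl fun i _ => ?_
  have hne (m : {m // G.Adj m n}) : (m : N) ≠ n := fun h => hn (by simpa only [h] using m.2)
  have hpa : (fun m : {m // G.Adj m n} => Function.update s n i m) =
      fun m : {m // G.Adj m n} => s m :=
    funext fun m => Function.update_of_ne (hne m) _ _
  unfold factor
  rw [Function.update_self, hpa]

open Classical in
/-- The joint state that is `a` on the parents of `n` and `s₀` elsewhere. -/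
noncomputable def extendState (s₀ : JointState r) (a : ∀ m : {m // G.Adj m n}, Fin (r m)) :
    JointState r :=
  fun m => if h : G.Adj m n then a ⟨m, h⟩ else s₀ m

/-- The causal model in which `n` has the distribution `k n s` when the joint state of its parents
is that of `s`. The state `s₀` only serves to extend the states of the parents to joint states. -/
noncomputable def ofKernel (s₀ : JointState r) (k : ∀ n, JointState r → Fin (r n) → ℝ)
    (hk : ∀ n s i, 0 ≤ k n s i) (hsum : ∀ n s, ∑ i, k n s i = 1) : CausalModel G r where
  cpt n a := k n (extendState s₀ a)
  cpt_nonneg _ _ := hk _ _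
  cpt_sum _ _ := hsum _ _

theorem factor_ofKernel {s₀ : JointState r} {k : ∀ n, JointState r → Fin (r n) → ℝ}
    {hk : ∀ n s i, 0 ≤ k n s i} {hsum : ∀ n s, ∑ i, k n s i = 1}
    (hlocal : ∀ s t, (∀ m, G.Adj m n → s m = t m) → k n s = k n t) :
    (ofKernel s₀ k hk hsum : CausalModel G r).factor n s = k n s (s n) := by
  refine congrFun (hlocal _ _ fun m hm => ?_) _
  exact dif_pos hm

end CausalModel

theorem IsDistribution.nonempty [Fintype N] [DecidableEq N] {P : JointState r → ℝ}
    (hP : IsDistribution P) : Nonempty (JointState r) := by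
  by_contra h
  rw [not_nonempty_iff] at h
  simpa using hP.2

end CausalModels

section ChainRule

variable {α β : Type*} [Fintype α] {f : α × β → ℝ} {a : α} {b : β}

/-- The marginal distribution of the second component. -/
def sndMarginal (f : α × β → ℝ) (b : β) : ℝ :=
  ∑ a, f (a, b)

/-- The conditional distribution of the first component, given that the second one is `b`; it is
uniform if this condition has probability zero. -/
noncomputable def fstConditional (f : α × β → ℝ) (b : β) (a : α) : ℝ :=
  if sndMarginal f b = 0 then (Fintype.card α : ℝ)⁻¹ else f (a, b) / sndMarginal f b

theorem sndMarginal_nonneg (hf : ∀ x, 0 ≤ f x) : 0 ≤ sndMarginal f b :=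
  Finset.sum_nonneg fun _ _ => hf _

theorem sum_sndMarginal [Fintype β] (f : α × β → ℝ) : ∑ b, sndMarginal f b = ∑ x, f x :=
  (Fintype.sum_prod_type_right f).symm

theorem fstConditional_nonneg (hf : ∀ x, 0 ≤ f x) : 0 ≤ fstConditional f b a := by
  unfold fstConditional
  split_ifs
  · positivity
  · exact div_nonneg (hf _) (sndMarginal_nonneg hf)

theorem sum_fstConditional [Nonempty α] (f : α × β → ℝ) (b : β) :
    ∑ a, fstConditional f b a = 1 := by
  unfold fstConditional
  split_ifs with h
  · simp
  · rw [← Finset.sum_div]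
    exact div_self h

theorem fstConditional_mul_sndMarginal (hf : ∀ x, 0 ≤ f x) :
    fstConditional f b a * sndMarginal f b = f (a, b) := by
  unfold fstConditional
  split_ifs with h
  · rw [h, mul_zero,
      (Finset.sum_eq_zero_iff_of_nonneg fun _ _ => hf _).1 h a (Finset.mem_univ a)]
  · exact div_mul_cancel₀ _ h

end ChainRule

section MergeState

variable {V : Type*} {G : Digraph (NodeZ V)} {r : V → ℕ} {p q : ℕ}

/-- The identification of the joint states of the new nodes with those of the original nodes. -/
def mergeEquiv : JointState (statesWU r p q) ≃ JointState (statesZ r p q) where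
  toFun := mergeState
  invFun s
    | .old v => s (.old v)
    | .w => (finProdFinEquiv.symm (s .z : Fin (p * q))).1
    | .u => (finProdFinEquiv.symm (s .z : Fin (p * q))).2
  left_inv s := by
    funext n
    cases n with
    | old v => rfl
    | w => exact congrArg Prod.fst (finProdFinEquiv.symm_apply_apply (s .w, s .u))
    | u => exact congrArg Prod.snd (finProdFinEquiv.symm_apply_apply (s .w, s .u))
  right_inv s := by
    funext n
    cases n with
    | old v => rfl
    | z => exact finProdFinEquiv.apply_symm_apply (s .z : Fin (p * q))

theorem mergeState_z_eq_iff (s : JointState (statesWU r p q)) (j : Fin p) (k : Fin q) :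
    mergeState s .z = finProdFinEquiv (j, k) ↔ s .w = j ∧ s .u = k :=
  (finProdFinEquiv.injective.eq_iff (a := ((s .w : Fin p), (s .u : Fin q)))).trans Prod.mk_inj

theorem mergeState_congr {s t : JointState (statesWU r p q)} {n : NodeZ V}
    (h : ∀ m : NodeWU V, m.merge = n → s m = t m) : mergeState s n = mergeState t n := by
  cases n with
  | old v => exact h (.old v) rfl
  | z => exact (mergeState_z_eq_iff s _ _).2 ⟨h .w rfl, h .u rfl⟩

theorem mergeEquiv_symm_congr {s t : JointState (statesZ r p q)} {n : NodeWU V}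
    (h : s n.merge = t n.merge) : mergeEquiv.symm s n = mergeEquiv.symm t n := by
  cases n with
  | old v => exact h
  | w => exact congrArg (fun i : Fin (p * q) => (finProdFinEquiv.symm i).1) h
  | u => exact congrArg (fun i : Fin (p * q) => (finProdFinEquiv.symm i).2) h

theorem mergeEquiv_symm_update_z [DecidableEq V] (s : JointState (statesZ r p q)) (j : Fin p)
    (k : Fin q) :
    mergeEquiv.symm (Function.update s .z (finProdFinEquiv (j, k))) =
      Function.update (Function.update (mergeEquiv.symm s) .u k) .w j := by
  funext n
  cases n with
  | old v => rfl
  | w => exact congrArg Prod.fst (finProdFinEquiv.symm_apply_apply (j, k))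
  | u => exact congrArg Prod.snd (finProdFinEquiv.symm_apply_apply (j, k))

theorem merge_eq_or_adj_of_adj {a b : NodeWU V} (hab : (splitGraph G).Adj a b) :
    a.merge = b.merge ∨ G.Adj a.merge b.merge :=
  or_iff_not_imp_left.2 fun hne => ((isModularQuotient_splitGraph G).adj_iff hne).1 hab

theorem splitGraph_adj_of_adj_merge (hz : ¬ G.Adj .z .z) {a b : NodeWU V}
    (hab : G.Adj a.merge b.merge) : (splitGraph G).Adj a b := by
  cases a <;> cases b <;> first | exact hab | exact absurd hab hz

theorem mergeState_parents_congr (hz : ¬ G.Adj .z .z) {s t : JointState (statesWU r p q)}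
    {n : NodeWU V} (h : ∀ m, (splitGraph G).Adj m n → s m = t m) :
    (fun m : {m // G.Adj m n.merge} => mergeState s m) =
      fun m : {m // G.Adj m n.merge} => mergeState t m := by
  funext ⟨m, hm⟩
  exact mergeState_congr fun m' hm' => h m' (splitGraph_adj_of_adj_merge hz (hm' ▸ hm))

variable [Fintype V] [DecidableEq V] {P : JointState (statesZ r p q) → ℝ}

theorem prob_splitData {E : JointState (statesZ r p q) → Prop}
    {E' : JointState (statesWU r p q) → Prop} (h : ∀ s, E' s ↔ E (mergeState s)) :
    prob (splitData P) E' = prob P E := by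
  classical
  exact Fintype.sum_equiv mergeEquiv _ _ fun s => if_congr (h s) rfl rfl

theorem IsDistribution.splitData (hP : IsDistribution P) : IsDistribution (splitData P) :=
  ⟨fun _ => hP.1 _, (Fintype.sum_equiv mergeEquiv _ _ fun _ => rfl).trans hP.2⟩

end MergeState

section MergeFactor

variable {V : Type*} {G : Digraph (NodeZ V)} {r : V → ℕ} {p q : ℕ}

namespace CausalModel

variable {M' : CausalModel (splitGraph G) (statesWU r p q)} {s t : JointState (statesZ r p q)}

theorem factor_mergeEquiv_symm_congr {n : NodeWU V} (hpa : ∀ m, G.Adj m n.merge → s m = t m)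
    (hn : s n.merge = t n.merge) :
    M'.factor n (mergeEquiv.symm s) = M'.factor n (mergeEquiv.symm t) :=
  factor_congr (fun _ hm => mergeEquiv_symm_congr <| (merge_eq_or_adj_of_adj hm).elim
    (fun h => h ▸ hn) (hpa _)) (mergeEquiv_symm_congr hn)

theorem sum_factor_w_mul_factor_u [DecidableEq V] :
    ∑ i, M'.factor .w (mergeEquiv.symm (Function.update s .z i)) *
      M'.factor .u (mergeEquiv.symm (Function.update s .z i)) = 1 := by
  let t (k : Fin (statesWU r p q .u)) := Function.update (mergeEquiv.symm s) .u k
  calc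
    _ = ∑ jk : Fin p × Fin q, M'.factor .w (Function.update (t jk.2) .w jk.1) *
          M'.factor .u (Function.update (t jk.2) .w jk.1) := by
      refine (finProdFinEquiv.sum_comp _).symm.trans (Finset.sum_congr rfl fun jk _ => ?_)
      rw [mergeEquiv_symm_update_z]
    _ = ∑ k, (∑ j, M'.factor .w (Function.update (t k) .w j)) * M'.factor .u (t k) := by
      refine (Fintype.sum_prod_type_right _).trans (Finset.sum_congr rfl fun k _ => ?_)
      rw [Finset.sum_mul]
      exact Finset.sum_congr rfl fun j _ => congrArg _ <|
        factor_update_of_not_adj (by simp) id _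
    _ = ∑ k, M'.factor .u (t k) :=
      Finset.sum_congr rfl fun k _ => by rw [sum_factor_update id, one_mul]
    _ = 1 := sum_factor_update id

end CausalModel

end MergeFactor

section Refinement

variable {V : Type*} [Fintype V] [DecidableEq V] {G : Digraph (NodeZ V)} {r : V → ℕ} {p q : ℕ}

namespace CausalModel

/-- The model `M'` on the new graph refines `M`: the factor of each original node is the product of
the factors of the new nodes it is split into. -/
def Refines (M' : CausalModel (splitGraph G) (statesWU r p q))
    (M : CausalModel G (statesZ r p q)) : Prop :=
  ∀ n s, ∏ n' with n'.merge = n, M'.factor n' s = M.factor n (mergeState s)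

variable {M' : CausalModel (splitGraph G) (statesWU r p q)} {M : CausalModel G (statesZ r p q)}

theorem refines_of_factor_eq
    (hold : ∀ v s, M'.factor (.old v) s = M.factor (.old v) (mergeState s))
    (hz : ∀ s, M'.factor .w s * M'.factor .u s = M.factor .z (mergeState s)) : M'.Refines M := by
  intro n s
  cases n with
  | old v =>
    have hfib : ({n' | n'.merge = .old v} : Finset (NodeWU V)) = {.old v} := by
      ext n'
      rw [Finset.mem_filter_univ]
      cases n' <;> simp [NodeWU.merge]
    rw [hfib, Finset.prod_singleton, hold]
  | z =>
    have hfib : ({n' | n'.merge = .z} : Finset (NodeWU V)) = {.w, .u} := by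
      ext n'
      rw [Finset.mem_filter_univ]
      cases n' <;> simp [NodeWU.merge]
    rw [hfib, Finset.prod_pair (by simp), hz]

namespace Refines

theorem observational_eq (h : M'.Refines M) : M'.observational = splitData M.observational :=
  funext fun s => (Finset.prod_fiberwise _ _ _).symm.trans
    (Finset.prod_congr rfl fun n _ => h n s)

theorem prod_erase_eq (h : M'.Refines M) (X : V) (s : JointState (statesWU r p q)) :
    ∏ n' ∈ Finset.univ.erase (.old X), M'.factor n' s =
      ∏ n ∈ Finset.univ.erase (.old X), M.factor n (mergeState s) := by
  have hmaps : ∀ n' ∈ Finset.univ.erase (NodeWU.old X),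
      n'.merge ∈ Finset.univ.erase (NodeZ.old X) := by
    simpa using fun n' hn' hX => hn' (NodeWU.eq_old_of_merge_eq hX)
  rw [← Finset.prod_fiberwise_of_maps_to hmaps]
  refine Finset.prod_congr rfl fun n hn => ?_
  have hfib : (Finset.univ.erase (NodeWU.old X)).filter (·.merge = n) =
      Finset.univ.filter (·.merge = n) := by
    refine Finset.filter_erase .. |>.trans (Finset.erase_eq_of_notMem fun hX => ?_)
    exact Finset.ne_of_mem_erase hn (Finset.mem_filter_univ _ |>.1 hX).symm
  rw [hfib, h]

theorem effect_eq (h : M'.Refines M) (X Y : V) :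
    M'.effect (.old X) (.old Y) = M.effect (.old X) (.old Y) := by
  funext x y
  have hdo : M'.interventional (.old X) x = splitData (M.interventional (.old X) x) :=
    funext fun s => congrArg (if s (.old X) = x then · else 0) (h.prod_erase_eq X s)
  unfold effect
  rw [hdo]
  exact prob_splitData fun s => Iff.rfl

end Refines

theorem exists_refinement (hz : ¬ G.Adj .z .z) (s₀ : JointState (statesWU r p q))
    (M : CausalModel G (statesZ r p q)) :
    ∃ M' : CausalModel (splitGraph G) (statesWU r p q), M'.Refines M := by
  let f (s : JointState (statesWU r p q)) (jk : Fin p × Fin q) : ℝ :=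
    M.cpt .z (fun m => mergeState s m) (finProdFinEquiv jk)
  have hf : ∀ s jk, 0 ≤ f s jk := fun _ _ => M.cpt_nonneg _ _ _
  have hf_sum : ∀ s, ∑ jk, f s jk = 1 := fun s =>
    (finProdFinEquiv.sum_comp _).trans (M.cpt_sum .z fun m => mergeState s m)
  have : Nonempty (Fin p) := ⟨s₀ .w⟩
  let k : ∀ n, JointState (statesWU r p q) → Fin (statesWU r p q n) → ℝ
    | .old v, s => M.cpt (.old v) fun m => mergeState s m
    | .w, s => fstConditional (f s) (s .u)
    | .u, s => sndMarginal (f s)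
  have hk : ∀ n s i, 0 ≤ k n s i
    | .old _, _, _ => M.cpt_nonneg _ _ _
    | .w, s, _ => fstConditional_nonneg (hf s)
    | .u, s, _ => sndMarginal_nonneg (hf s)
  have hk_sum : ∀ n s, ∑ i, k n s i = 1
    | .old v, s => M.cpt_sum (.old v) fun m => mergeState s m
    | .w, s => sum_fstConditional (f s) _
    | .u, s => (sum_sndMarginal (f s)).trans (hf_sum s)
  have hlocal : ∀ n s t, (∀ m, (splitGraph G).Adj m n → s m = t m) → k n s = k n t := by
    intro n s t hst
    have hpa := mergeState_parents_congr hz hst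
    cases n with
    | old v => exact congrArg (M.cpt (.old v)) hpa
    | w =>
      exact congrArg₂ fstConditional (congrArg (fun a jk => M.cpt .z a (finProdFinEquiv jk)) hpa)
        (hst .u trivial)
    | u => exact congrArg (fun a => sndMarginal fun jk => M.cpt .z a (finProdFinEquiv jk)) hpa
  refine ⟨ofKernel s₀ k hk hk_sum, refines_of_factor_eq (fun v s => ?_) fun s => ?_⟩
  · rw [factor_ofKernel (hlocal _)]
    rfl
  · rw [factor_ofKernel (hlocal _), factor_ofKernel (hlocal _)]
    exact fstConditional_mul_sndMarginal (hf s)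

theorem exists_coarsening (s₀ : JointState (statesZ r p q))
    (M' : CausalModel (splitGraph G) (statesWU r p q)) :
    ∃ M : CausalModel G (statesZ r p q), M'.Refines M := by
  let k : ∀ n, JointState (statesZ r p q) → Fin (statesZ r p q n) → ℝ
    | .old v, s => M'.cpt (.old v) fun m => mergeEquiv.symm s m
    | .z, s => fun i => M'.factor .w (mergeEquiv.symm (Function.update s .z i)) *
      M'.factor .u (mergeEquiv.symm (Function.update s .z i))
  have hk : ∀ n s i, 0 ≤ k n s i
    | .old _, _, _ => M'.cpt_nonneg _ _ _
    | .z, _, _ => mul_nonneg factor_nonneg factor_nonneg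
  have hk_sum : ∀ n s, ∑ i, k n s i = 1
    | .old v, s => M'.cpt_sum (.old v) fun m => mergeEquiv.symm s m
    | .z, s => sum_factor_w_mul_factor_u
  have hlocal : ∀ n s t, (∀ m, G.Adj m n → s m = t m) → k n s = k n t := by
    intro n s t hst
    cases n with
    | old v =>
      have hadj : ∀ m, (splitGraph G).Adj m (.old v) → G.Adj m.merge (.old v) := by
        rintro (_ | _ | _) hm <;> exact hm
      exact congrArg (M'.cpt (.old v)) <|
        funext fun m => mergeEquiv_symm_congr (hst _ (hadj m m.2))
    | z =>
      funext i
      have hpa : ∀ m, G.Adj m .z → Function.update s .z i m = Function.update t .z i m := by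
        intro m hm
        obtain rfl | hmz := eq_or_ne m .z
        · simp only [Function.update_self]
        · rw [Function.update_of_ne hmz, Function.update_of_ne hmz, hst m hm]
      have hz : Function.update s .z i .z = Function.update t .z i .z := by
        simp only [Function.update_self]
      exact congrArg₂ (· * ·) (factor_mergeEquiv_symm_congr (n := .w) hpa hz)
        (factor_mergeEquiv_symm_congr (n := .u) hpa hz)
  refine ⟨ofKernel s₀ k hk hk_sum, refines_of_factor_eq (fun v s => ?_) fun s => ?_⟩
  · rw [factor_ofKernel (hlocal _)]
    exact (congrArg (M'.factor (.old v)) (mergeEquiv.symm_apply_apply s)).symm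
  · rw [factor_ofKernel (hlocal _)]
    dsimp only [k]
    rw [Function.update_eq_self, show mergeEquiv.symm (mergeState s) = s from
      mergeEquiv.symm_apply_apply s]

end CausalModel

end Refinement

section Equivalence

variable {V : Type*} [Fintype V] [DecidableEq V] {G : Digraph (NodeZ V)} {r : V → ℕ} {p q : ℕ}

theorem Compatible.splitData {P : JointState (statesZ r p q) → ℝ} (hz : ¬ G.Adj .z .z)
    (hP : Compatible G P) : Compatible (splitGraph G) (splitData P) := by
  obtain ⟨hD, M, rfl⟩ := hP
  obtain ⟨s₀⟩ := hD.splitData.nonempty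
  obtain ⟨M', hM'⟩ := CausalModel.exists_refinement hz s₀ M
  exact ⟨hD.splitData, M', hM'.observational_eq⟩

theorem causalEffects_splitGraph (hz : ¬ G.Adj .z .z) (s₀ : JointState (statesZ r p q))
    (P : JointState (statesZ r p q) → ℝ) (X Y : V) :
    causalEffects (splitGraph G) (splitData P) (.old X) (.old Y) =
      causalEffects G P (.old X) (.old Y) := by
  have hinj : Function.Injective
      (splitData : (JointState (statesZ r p q) → ℝ) → JointState (statesWU r p q) → ℝ) :=
    mergeEquiv.surjective.injective_comp_right
  ext e
  constructor
  · rintro ⟨M', hM', rfl⟩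
    obtain ⟨M, hM⟩ := CausalModel.exists_coarsening s₀ M'
    exact ⟨M, hinj (hM.observational_eq.symm.trans hM'), hM.effect_eq X Y⟩
  · rintro ⟨M, rfl, rfl⟩
    obtain ⟨M', hM'⟩ := CausalModel.exists_refinement hz (mergeEquiv.symm s₀) M
    exact ⟨M', hM'.observational_eq, (hM'.effect_eq X Y).symm⟩

theorem prob_splitData_w_u (P : JointState (statesZ r p q) → ℝ) (S : Finset V)
    (t : ∀ v, Fin (r v)) (j : Fin p) (k : Fin q) :
    prob (splitData P) (fun s => s .w = j ∧ s .u = k ∧ ∀ v ∈ S, s (.old v) = t v) =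
      prob P (fun s => s .z = finProdFinEquiv (j, k) ∧ ∀ v ∈ S, s (.old v) = t v) := by
  refine prob_splitData fun s => ?_
  rw [mergeState_z_eq_iff, and_assoc]
  rfl

/-- The identification of the joint states of `splitSet Q` with those of `Q`. -/
def mergeSetEquiv (Q : Finset (NodeZ V)) :
    (∀ n : splitSet Q, Fin (statesWU r p q n)) ≃ (∀ n : Q, Fin (statesZ r p q n)) where
  toFun a
    | ⟨.old v, h⟩ => a ⟨.old v, mem_splitSet.2 h⟩
    | ⟨.z, h⟩ =>
      finProdFinEquiv ((a ⟨.w, mem_splitSet.2 h⟩ : Fin p), (a ⟨.u, mem_splitSet.2 h⟩ : Fin q))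
  invFun a
    | ⟨.old v, h⟩ => a ⟨.old v, mem_splitSet.1 h⟩
    | ⟨.w, h⟩ => (finProdFinEquiv.symm (a ⟨.z, mem_splitSet.1 h⟩ : Fin (p * q))).1
    | ⟨.u, h⟩ => (finProdFinEquiv.symm (a ⟨.z, mem_splitSet.1 h⟩ : Fin (p * q))).2
  left_inv a := by
    funext ⟨n, h⟩
    cases n with
    | old v => rfl
    | w => exact congrArg Prod.fst (finProdFinEquiv.symm_apply_apply ((_ : Fin p), (_ : Fin q)))
    | u => exact congrArg Prod.snd (finProdFinEquiv.symm_apply_apply ((_ : Fin p), (_ : Fin q)))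
  right_inv a := by
    funext ⟨n, h⟩
    cases n with
    | old v => rfl
    | z => exact finProdFinEquiv.apply_symm_apply (_ : Fin (p * q))

theorem forall_splitSet_eq_iff {Q : Finset (NodeZ V)} (s : JointState (statesWU r p q))
    (a : ∀ n : splitSet Q, Fin (statesWU r p q n)) :
    (∀ n : splitSet Q, s n = a n) ↔ ∀ n : Q, mergeState s n = mergeSetEquiv Q a n := by
  constructor
  · rintro h ⟨n, hn⟩
    cases n with
    | old v => exact h ⟨.old v, mem_splitSet.2 hn⟩
    | z =>
      exact (mergeState_z_eq_iff s _ _).2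
        ⟨h ⟨.w, mem_splitSet.2 hn⟩, h ⟨.u, mem_splitSet.2 hn⟩⟩
  · rintro h ⟨n, hn⟩
    cases n with
    | old v => exact h ⟨.old v, mem_splitSet.1 hn⟩
    | w => exact ((mergeState_z_eq_iff s _ _).1 (h ⟨.z, mem_splitSet.1 hn⟩)).1
    | u => exact ((mergeState_z_eq_iff s _ _).1 (h ⟨.z, mem_splitSet.1 hn⟩)).2

variable (P : JointState (statesZ r p q) → ℝ) (X Y : V) (Q : Finset (NodeZ V))

theorem backDoorFormula_splitData (x : Fin (r X)) (y : Fin (r Y)) :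
    backDoorFormula (splitData P) (.old X) (.old Y) (splitSet Q) x y =
      backDoorFormula P (.old X) (.old Y) Q x y := by
  refine Fintype.sum_equiv (mergeSetEquiv Q) _ _ fun a => ?_
  simp only [forall_splitSet_eq_iff]
  refine congrArg₂ (· * ·) (congrArg₂ (· / ·) ?_ ?_) ?_ <;> exact prob_splitData fun _ => Iff.rfl

theorem frontDoorFormula_splitData (x : Fin (r X)) (y : Fin (r Y)) :
    frontDoorFormula (splitData P) (.old X) (.old Y) (splitSet Q) x y =
      frontDoorFormula P (.old X) (.old Y) Q x y := by
  refine Fintype.sum_equiv (mergeSetEquiv Q) _ _ fun a => ?_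
  simp only [forall_splitSet_eq_iff]
  refine congrArg₂ (· * ·) (congrArg₂ (· / ·) ?_ ?_) (Finset.sum_congr rfl fun x' _ =>
    congrArg₂ (· * ·) (congrArg₂ (· / ·) ?_ ?_) ?_) <;> exact prob_splitData fun _ => Iff.rfl

theorem backDoor_splitGraph (hQ : G.BackDoor (.old X) (.old Y) Q) :
    (splitGraph G).BackDoor (.old X) (.old Y) (splitSet Q) :=
  (isModularQuotient_splitGraph G).backDoor (fun _ => mem_splitSet)
    (fun _ => NodeWU.eq_old_of_merge_eq) hQ

theorem frontDoor_splitGraph (hQ : G.FrontDoor (.old X) (.old Y) Q) :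
    (splitGraph G).FrontDoor (.old X) (.old Y) (splitSet Q) :=
  (isModularQuotient_splitGraph G).frontDoor (fun _ => mem_splitSet)
    (fun _ => NodeWU.eq_old_of_merge_eq) hQ

end Equivalence

theorem theorem3_general {V : Type*} [Fintype V] [DecidableEq V] (X Y : V)
    (r : V → ℕ) (p q : ℕ) (G : Digraph (NodeZ V)) (hz : ¬ G.Adj .z .z)
    (P : JointState (statesZ r p q) → ℝ) (hP : Compatible G P) :
    (G.Acyclic → (splitGraph G).Acyclic) ∧ Compatible (splitGraph G) (splitData P) ∧
    (∀ (S : Finset V) (t : ∀ v, Fin (r v)) (j : Fin p) (k : Fin q),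
      prob (splitData P)
          (fun s => s .w = j ∧ s .u = k ∧ ∀ v ∈ S, s (.old v) = t v) =
        prob P (fun s => s .z = finProdFinEquiv (j, k) ∧ ∀ v ∈ S, s (.old v) = t v)) ∧
    (∀ Q : Finset (NodeZ V), G.BackDoor (.old X) (.old Y) Q →
      (splitGraph G).BackDoor (.old X) (.old Y) (splitSet Q) ∧
      ∀ (x : Fin (r X)) (y : Fin (r Y)),
        backDoorFormula (splitData P) (.old X) (.old Y) (splitSet Q) x y =
          backDoorFormula P (.old X) (.old Y) Q x y) ∧
    (∀ Q : Finset (NodeZ V), G.FrontDoor (.old X) (.old Y) Q →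
      (splitGraph G).FrontDoor (.old X) (.old Y) (splitSet Q) ∧
      ∀ (x : Fin (r X)) (y : Fin (r Y)),
        frontDoorFormula (splitData P) (.old X) (.old Y) (splitSet Q) x y =
          frontDoorFormula P (.old X) (.old Y) Q x y) ∧
    causalEffects (splitGraph G) (splitData P) (.old X) (.old Y) =
      causalEffects G P (.old X) (.old Y) := by
  obtain ⟨s₀⟩ := hP.1.nonempty
  exact ⟨splitGraph_acyclic, hP.splitData hz, prob_splitData_w_u P,
    fun Q hQ => ⟨backDoor_splitGraph X Y Q hQ, backDoorFormula_splitData P X Y Q⟩,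
    fun Q hQ => ⟨frontDoor_splitGraph X Y Q hQ, frontDoorFormula_splitData P X Y Q⟩,
    causalEffects_splitGraph hz s₀ P X Y⟩

theorem theorem3 {V : Type*} [Fintype V] [DecidableEq V] (X Y : V) (hXY : X ≠ Y)
    (r : V → ℕ) (p q : ℕ) (G : Digraph (NodeZ V)) (hG : G.Acyclic)
    (P : JointState (statesZ r p q) → ℝ) (hP : Compatible G P) :
    -- the new graph is a causal diagram, and the new data are compatible with it
    (splitGraph G).Acyclic ∧ Compatible (splitGraph G) (splitData P) ∧
    -- `P'(w_j, u_k, t) = P(z_{jq+k}, t)` for all states `t` of any set `S` of other nodes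
    (∀ (S : Finset V) (t : ∀ v, Fin (r v)) (j : Fin p) (k : Fin q),
      prob (splitData P)
          (fun s => s .w = j ∧ s .u = k ∧ ∀ v ∈ S, s (.old v) = t v) =
        prob P (fun s => s .z = finProdFinEquiv (j, k) ∧ ∀ v ∈ S, s (.old v) = t v)) ∧
    -- the back-door criterion carries over, and the adjustment formula has the same value
    (∀ Q : Finset (NodeZ V), G.BackDoor (.old X) (.old Y) Q →
      (splitGraph G).BackDoor (.old X) (.old Y) (splitSet Q) ∧
      ∀ (x : Fin (r X)) (y : Fin (r Y)),
        backDoorFormula (splitData P) (.old X) (.old Y) (splitSet Q) x y =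
          backDoorFormula P (.old X) (.old Y) Q x y) ∧
    -- the front-door criterion carries over, and the adjustment formula has the same value
    (∀ Q : Finset (NodeZ V), G.FrontDoor (.old X) (.old Y) Q →
      (splitGraph G).FrontDoor (.old X) (.old Y) (splitSet Q) ∧
      ∀ (x : Fin (r X)) (y : Fin (r Y)),
        frontDoorFormula (splitData P) (.old X) (.old Y) (splitSet Q) x y =
          frontDoorFormula P (.old X) (.old Y) Q x y) ∧
    -- the causal effects of `X` on `Y` are the same
    causalEffects (splitGraph G) (splitData P) (.old X) (.old Y) =
      causalEffects G P (.old X) (.old Y) :=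
  (theorem3_general X Y r p q G (fun h => hG _ (.single h)) P hP).imp_left (· hG)
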